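/- Let $\mathcal X,\mathcal Y$ be finite alphabets, $\mathcal H$ a finite-dimensional complex Hilbert space, and $W:\mathcal X\times\mathcal Y\to\mathcal S(\mathcal H)$ a map into the density operators on $\mathcal H$. It generates the discrete memoryless CCQ channel $W^k(x^k,y^k)=\bigotimes_{i=1}^k W(x_i,y_i)$, $k\in\mathbb N$. All logarithms have base $2$. A $(k,M,N)$-code ($M,N\ge 1$) consists of words $x_1,\dots,x_M\in\mathcal X^k$, $y_1,\dots,y_N\in\mathcal Y^k$ and a POVM $(D_{mn})_{m\in[M],n\in[N]}$ on $\mathcal H^{\otimes k}$; its average error is $\bar e=1-\frac1{MN}\sum_{m,n}\mathrm{tr}(D_{mn}W^k(x_m,y_n))$. The capacity region $C(W)$ is the set of all $(R_1,R_2)$ with $R_1,R_2\ge 0$ such that for all $\epsilon,\delta>0$ there is a $k_0$ such that for every $k\ge k_0$ there is a $(k,M,N)$-code with $\frac1k\log M\ge R_1-\delta$, $\frac1k\log N\ge R_2-\delta$ and $\bar e\le\epsilon$. A $(k,M,N)$-ID-code ($M,N\ge1$) consists of probability distributions $P_1,\dots,P_M$ on $\mathcal X^k$ and $Q_1,\dots,Q_N$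 on $\mathcal Y^k$, and operators $0\le I_{mn}\le \mathbb 1$ on $\mathcal H^{\otimes k}$. Its errors of the first and second kind are $$e_1=\max_{m,n}\Big(1-\sum_{x^k,y^k}P_m(x^k)Q_n(y^k)\,\mathrm{tr}(I_{mn}W^k(x^k,y^k))\Big),\qquad e_2=\max_{(m,n)\ne(m',n')}\sum_{x^k,y^k}P_m(x^k)Q_n(y^k)\,\mathrm{tr}(I_{m'n'}W^k(x^k,y^k)),$$ where $e_2=0$ if $M=N=1$. The ID-code is simultaneous if there are $R,S\in\mathbb N$, a POVM $(E_{rs})_{r\in[R],s\in[S]}$ on $\mathcal H^{\otimes k}$ and subsets $A_1,\dots,A_M\subseteq[R]$, $B_1,\dots,B_N\subseteq[S]$ with $I_{mn}=\sum_{i\in A_m}\sum_{j\in B_n}E_{ij}$ for all $m,n$. The simultaneous ID capacity region $C_{\mathrm{id}}^{\mathrm{sim}}(W)$ is the set of all $(R_1,R_2)$ with $R_1,R_2\ge0$ such that for all $\epsilon_1,\epsilon_2,\delta>0$ there is a $k_0$ such that for every $k\ge k_0$ there is a simultaneous $(k,M,N)$-ID-code with $\frac1k\log\log M\ge R_1-\delta$,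 $\frac1k\log\log N\ge R_2-\delta$, $e_1\le\epsilon_1$ and $e_2\le\epsilon_2$; here a sender with a single message has identification rate $0$, i.e. $\frac1k\log\log 1$ is read as $0$. Theorem. $C(W)\subseteq C_{\mathrm{id}}^{\mathrm{sim}}(W)$. -/

import Mathlib

open scoped ComplexOrder Matrix

noncomputable section

namespace CCQ

/-! ### States, tensor powers and measurements

The finite-dimensional Hilbert space `ℂ^d` is indexed by a finite type `d`; its `k`-fold tensor power
has the product basis indexed by `Fin k → d`, and operators are complex matrices in these bases. -/

/-- A quantum state (density operator) on the Hilbert space with basis `d`. -/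
structure DensityMatrix (d : Type*) [Fintype d] where
  /-- the underlying operator -/
  val : Matrix d d ℂ
  posSemidef : val.PosSemidef
  trace_eq_one : val.trace = 1

/-- The tensor product `A 0 ⊗ A 1 ⊗ ⋯ ⊗ A (k - 1)` of operators, in the product basis. -/
def tensorProd {d : Type*} {k : ℕ} (A : Fin k → Matrix d d ℂ) : Matrix (Fin k → d) (Fin k → d) ℂ :=
  Matrix.of fun f g => ∏ i, A i (f i) (g i)

theorem tensorProd_mul {d : Type*} [Fintype d] {k : ℕ} (A B : Fin k → Matrix d d ℂ) :
    tensorProd A * tensorProd B = tensorProd fun i => A i * B i := by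
  classical
  ext f g
  simp only [tensorProd, Matrix.mul_apply, Matrix.of_apply, ← Finset.prod_mul_distrib]
  rw [Finset.prod_univ_sum, Fintype.piFinset_univ]

theorem tensorProd_conjTranspose {d : Type*} {k : ℕ} (A : Fin k → Matrix d d ℂ) :
    (tensorProd A)ᴴ = tensorProd fun i => (A i)ᴴ := by
  ext f g
  simp [tensorProd, Matrix.conjTranspose_apply]

theorem tensorProd_trace {d : Type*} [Fintype d] {k : ℕ} (A : Fin k → Matrix d d ℂ) :
    (tensorProd A).trace = ∏ i, (A i).trace := by
  classical
  simp only [tensorProd, Matrix.trace, Matrix.diag_apply, Matrix.of_apply]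
  rw [Finset.prod_univ_sum, Fintype.piFinset_univ]

open scoped MatrixOrder Matrix.Norms.L2Operator in
theorem tensorProd_posSemidef {d : Type*} [Fintype d] {k : ℕ} (A : Fin k → Matrix d d ℂ)
    (hA : ∀ i, (A i).PosSemidef) : (tensorProd A).PosSemidef := by
  classical
  have h : ∀ i, ∃ B : Matrix d d ℂ, A i = Bᴴ * B := fun i =>
    CStarAlgebra.nonneg_iff_eq_star_mul_self.mp (Matrix.nonneg_iff_posSemidef.mpr (hA i))
  choose B hB using h
  have : tensorProd A = (tensorProd B)ᴴ * tensorProd B := by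
    rw [tensorProd_conjTranspose, tensorProd_mul]
    exact congrArg tensorProd (funext hB)
  rw [this]
  exact Matrix.posSemidef_conjTranspose_mul_self _

/-- The product state `ρ 0 ⊗ ρ 1 ⊗ ⋯ ⊗ ρ (k - 1)`. -/
def productState {d : Type*} [Fintype d] {k : ℕ} (ρ : Fin k → DensityMatrix d) :
    DensityMatrix (Fin k → d) where
  val := tensorProd fun i => (ρ i).val
  posSemidef := tensorProd_posSemidef _ fun i => (ρ i).posSemidef
  trace_eq_one := by
    rw [tensorProd_trace]
    exact Finset.prod_eq_one fun i _ => (ρ i).trace_eq_one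

/-- A finite family of operators is a POVM: positive semidefinite, summing to the identity. -/
def IsPOVM {ι d : Type*} [Fintype ι] [Fintype d] [DecidableEq d] (E : ι → Matrix d d ℂ) : Prop :=
  (∀ i, (E i).PosSemidef) ∧ ∑ i, E i = 1

/-! ### Classical-classical-quantum channels -/

/-- A CCQ channel: for every blocklength `k`, a map `X^k × Y^k → S(H^{⊗k})`. -/
def Channel (X Y d : Type*) [Fintype d] : Type _ :=
  (k : ℕ) → (Fin k → X) → (Fin k → Y) → DensityMatrix (Fin k → d)

/-- The discrete memoryless CCQ channel generated by `W`:
`W^k(x^k, y^k) = W(x_1, y_1) ⊗ ⋯ ⊗ W(x_k, y_k)`. -/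
def memoryless {X Y d : Type*} [Fintype d] (W : X → Y → DensityMatrix d) : Channel X Y d :=
  fun _ x y => productState fun i => W (x i) (y i)

/-! ### Message transmission -/

/-- A `(k, M, N)`-code for classical message transmission. -/
structure TransmissionCode (X Y d : Type*) [Fintype d] [DecidableEq d] (k M N : ℕ) where
  /-- code words of the first sender -/
  x : Fin M → (Fin k → X)
  /-- code words of the second sender -/
  y : Fin N → (Fin k → Y)
  /-- decoding operators -/
  D : Fin M × Fin N → Matrix (Fin k → d) (Fin k → d) ℂ
  isPOVM : IsPOVM D

/-- Average error of transmission. -/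
def TransmissionCode.avgError {X Y d : Type*} [Fintype d] [DecidableEq d] {k M N : ℕ}
    (C : TransmissionCode X Y d k M N) (W : Channel X Y d) : ℝ :=
  1 - (1 / ((M : ℝ) * (N : ℝ))) *
    ∑ m : Fin M, ∑ n : Fin N, (C.D (m, n) * (W k (C.x m) (C.y n)).val).trace.re

/-- `(R₁, R₂)` is an achievable rate pair for message transmission (average error). -/
def IsAchievable {X Y d : Type*} [Fintype d] [DecidableEq d] (W : Channel X Y d) (R₁ R₂ : ℝ) :
    Prop :=
  0 ≤ R₁ ∧ 0 ≤ R₂ ∧ ∀ ε > (0 : ℝ), ∀ δ > (0 : ℝ), ∃ k₀ : ℕ, ∀ k ≥ k₀, ∃ M N : ℕ, 0 < M ∧ 0 < N ∧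
    ∃ C : TransmissionCode X Y d k M N,
      (1 / (k : ℝ)) * Real.logb 2 M ≥ R₁ - δ ∧ (1 / (k : ℝ)) * Real.logb 2 N ≥ R₂ - δ ∧
      C.avgError W ≤ ε

/-- The (average error) message transmission capacity region `C(W)`. -/
def capacityRegion {X Y d : Type*} [Fintype d] [DecidableEq d] (W : Channel X Y d) : Set (ℝ × ℝ) :=
  {R | IsAchievable W R.1 R.2}

/-! ### Message identification -/

/-- A `(k, M, N)`-ID-code. -/
structure IDCode (X Y d : Type*) [Fintype X] [Fintype Y] [Fintype d] [DecidableEq d]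
    (k M N : ℕ) where
  /-- input distributions of the first sender -/
  P : Fin M → (Fin k → X) → ℝ
  /-- input distributions of the second sender -/
  Q : Fin N → (Fin k → Y) → ℝ
  /-- identifiers -/
  I : Fin M → Fin N → Matrix (Fin k → d) (Fin k → d) ℂ
  P_mem : ∀ m, P m ∈ stdSimplex ℝ (Fin k → X)
  Q_mem : ∀ n, Q n ∈ stdSimplex ℝ (Fin k → Y)
  I_nonneg : ∀ m n, (I m n).PosSemidef
  I_le_one : ∀ m n, (1 - I m n).PosSemidef

namespace IDCode

variable {X Y d : Type*} [Fintype X] [Fintype Y] [Fintype d] [DecidableEq d] {k M N : ℕ}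

/-- The probability that the test for `(m', n')` accepts when `(m, n)` is sent, i.e.
`∑_{x,y} P_m(x) Q_n(y) tr(I_{m'n'} W^k(x, y))`. -/
def acceptProb (C : IDCode X Y d k M N) (W : Channel X Y d) (m : Fin M) (n : Fin N) (m' : Fin M)
    (n' : Fin N) : ℝ :=
  ∑ x : Fin k → X, ∑ y : Fin k → Y, C.P m x * C.Q n y * (C.I m' n' * (W k x y).val).trace.re

/-- Error of the first kind: the maximum over all message pairs `(m, n)`. -/
def error₁ (C : IDCode X Y d k M N) (W : Channel X Y d) : ℝ :=
  ⨆ p : Fin M × Fin N, (1 - C.acceptProb W p.1 p.2 p.1 p.2)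

/-- Error of the second kind: the maximum over all pairs `(m, n) ≠ (m', n')`.
It is `0` if there is no such pair, i.e. if `M = N = 1`. -/
def error₂ (C : IDCode X Y d k M N) (W : Channel X Y d) : ℝ :=
  ⨆ p : {p : (Fin M × Fin N) × (Fin M × Fin N) // p.1 ≠ p.2},
    C.acceptProb W p.1.1.1 p.1.1.2 p.1.2.1 p.1.2.2

/-- The ID-code is simultaneous: all its identifiers are obtained by grouping the outcomes of one
single POVM along product sets `A_m × B_n`. -/
def IsSimultaneous (C : IDCode X Y d k M N) : Prop :=
  ∃ (R S : ℕ) (E : Fin R × Fin S → Matrix (Fin k → d) (Fin k → d) ℂ)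
    (A : Fin M → Finset (Fin R)) (B : Fin N → Finset (Fin S)),
    IsPOVM E ∧ ∀ m n, C.I m n = ∑ i ∈ A m, ∑ j ∈ B n, E (i, j)

end IDCode

/-- The identification rate `(1/k) log log M` of a sender with `M` messages. A sender with a single
message (for whom `log log M` is not defined) has rate `0`. -/
def idRate (k M : ℕ) : ℝ :=
  if M ≤ 1 then 0 else (1 / (k : ℝ)) * Real.logb 2 (Real.logb 2 M)

/-- `(R₁, R₂)` is an achievable simultaneous ID-rate pair. -/
def IsSimIDAchievable {X Y d : Type*} [Fintype X] [Fintype Y] [Fintype d] [DecidableEq d]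
    (W : Channel X Y d) (R₁ R₂ : ℝ) : Prop :=
  0 ≤ R₁ ∧ 0 ≤ R₂ ∧ ∀ ε₁ > (0 : ℝ), ∀ ε₂ > (0 : ℝ), ∀ δ > (0 : ℝ),
    ∃ k₀ : ℕ, ∀ k ≥ k₀, ∃ M N : ℕ, 0 < M ∧ 0 < N ∧ ∃ C : IDCode X Y d k M N, C.IsSimultaneous ∧
      idRate k M ≥ R₁ - δ ∧ idRate k N ≥ R₂ - δ ∧ C.error₁ W ≤ ε₁ ∧ C.error₂ W ≤ ε₂

/-- The simultaneous ID capacity region. -/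
def simIDCapacityRegion {X Y d : Type*} [Fintype X] [Fintype Y] [Fintype d] [DecidableEq d]
    (W : Channel X Y d) : Set (ℝ × ℝ) :=
  {R | IsSimIDAchievable W R.1 R.2}

end CCQ

end

/-!
Simultaneous identification at the rates of a transmission code, by the method of random subsets.

Take a transmission code with `M' × N'` messages, rates at least `R₁ - δ/2`, `R₂ - δ/2` and very small
average error. An identification message of the first sender is a tuple of `L ≈ 2 ^ (k (R₁ - δ))`
code messages, one of which is transmitted at random; likewise for the second sender, with tuples of
length `K ≈ 2 ^ (k (R₂ - δ))`. The single POVM is the transmission decoder, and the test for a pair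
of identification messages accepts if both decoded components lie in the ranges of the two tuples.
The error of the first kind for a pair of tuples is at most the mean transmission error over the
rectangle which they span; for the second kind one adds the relative overlap of two distinct tuples
of one sender (`TransmissionCode.toIDCode_error₁_le`, `TransmissionCode.toIDCode_error₂_le`).

So one needs `2 ^ L` tuples and `2 ^ K` tuples with small overlaps such that *every* rectangle has
small mean error (`exists_rectangles`), although only the mean of the error over all message pairs
is controlled. By the Chernoff bound `card_tuples_mul_le`, a random tuple of length `L` is bad for
a given function of small mean with probability at most `8 ^ (-L)`; hence most tuples are good for
`2 ^ L` given functions at once, and a greedy choice (`exists_pairwise_not_rel`) yields `2 ^ L` good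
tuples with small overlaps. The two families are chosen one after the other, the smaller one first:
its members need to be good only on average over the other sender's messages, and if `K ≤ L`, then
the `2 ^ K` resulting mean error functions are few enough for the choice of the tuples of length `L`.
This is why average error suffices, and no reduction to maximal error, which is impossible in
general for several senders, is needed.
-/

namespace CCQ

/-! ### Concentration of empirical means of tuples -/

/-- The density threshold `16 ^ (-1/r)` below which a `[0, 1]`-valued function has empirical mean
at least `r` only for an exponentially small fraction of tuples. -/
noncomputable def threshold (r : ℝ) : ℝ := (16 : ℝ) ^ (-(1 / r))

theorem threshold_pos (r : ℝ) : 0 < threshold r := Real.rpow_pos_of_pos (by norm_num) _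

theorem threshold_le_self {r : ℝ} (hr : 0 < r) (hr1 : r ≤ 1) : threshold r ≤ r := by
  have h1 : 1 ≤ 1 / r := by rw [le_div_iff₀ hr]; linarith
  have h := one_add_mul_self_le_rpow_one_add (s := 15) (by norm_num) h1
  rw [threshold, Real.rpow_neg (by norm_num), inv_le_comm₀ (Real.rpow_pos_of_pos (by norm_num) _) hr]
  norm_num at h
  rw [one_div]
  linarith [inv_pos.mpr hr]

/-- Chernoff bound, in counting form: if `g : α → [0, 1]` has mean at most `threshold r`, then the
fraction of tuples of length `L` along which the empirical mean of `g` is at least `r` is at most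
`8 ^ (-L)`. -/
theorem card_tuples_mul_le {α : Type*} [Fintype α] {g : α → ℝ} {r : ℝ} (hr : 0 < r)
    (h0 : ∀ x, 0 ≤ g x) (h1 : ∀ x, g x ≤ 1)
    (hg : ∑ x, g x ≤ threshold r * Fintype.card α) (L : ℕ) :
    ((Finset.univ.filter fun a : Fin L → α => r * L ≤ ∑ i, g (a i)).card : ℝ) * 8 ^ L
      ≤ (Fintype.card (Fin L → α) : ℝ) := by
  classical
  set z : ℝ := (16 : ℝ) ^ (1 / r) with hz
  have hz1 : 1 ≤ z := Real.one_le_rpow (by norm_num) (by positivity)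
  have hz0 : 0 < z := by linarith
  have hth : threshold r = z⁻¹ := by rw [threshold, Real.rpow_neg (by norm_num)]
  -- exponential moment with base `z = 16 ^ (1/r)`
  have hmean : ∑ x, z ^ g x ≤ 2 * Fintype.card α := by
    have hb : ∀ x, z ^ g x ≤ 1 + (z - 1) * g x := fun x => by
      have := rpow_one_add_le_one_add_mul_self (s := z - 1) (by linarith) (h0 x) (h1 x)
      rw [add_sub_cancel] at this
      linarith
    calc ∑ x, z ^ g x ≤ ∑ x, (1 + (z - 1) * g x) := Finset.sum_le_sum fun x _ => hb x
      _ = Fintype.card α + (z - 1) * ∑ x, g x := by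
        rw [Finset.sum_add_distrib, ← Finset.mul_sum]; simp
      _ ≤ Fintype.card α + (z - 1) * (z⁻¹ * Fintype.card α) := by
        rw [← hth]; gcongr
      _ = 2 * Fintype.card α - z⁻¹ * Fintype.card α := by field_simp; ring
      _ ≤ 2 * Fintype.card α := by
        have : 0 ≤ z⁻¹ * (Fintype.card α : ℝ) := by positivity
        linarith
  have hprod : ∑ a : Fin L → α, ∏ i, z ^ g (a i) = (∑ x, z ^ g x) ^ L := by
    have := (Finset.prod_univ_sum (fun _ : Fin L => (Finset.univ : Finset α))
      (fun _ x => z ^ g x)).symm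
    rw [Fintype.piFinset_univ] at this
    simpa using this
  have hlow : ((Finset.univ.filter fun a : Fin L → α => r * L ≤ ∑ i, g (a i)).card : ℝ) * 16 ^ L
      ≤ ∑ a : Fin L → α, ∏ i, z ^ g (a i) := by
    rw [← nsmul_eq_mul, ← Finset.sum_const]
    refine (Finset.sum_le_sum fun a ha => ?_).trans
      (Finset.sum_le_sum_of_subset_of_nonneg (Finset.subset_univ _) fun a _ _ =>
        Finset.prod_nonneg fun i _ => (Real.rpow_pos_of_pos hz0 _).le)
    rw [← Real.rpow_sum_of_pos hz0]
    calc (16 : ℝ) ^ L = z ^ (r * L) := by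
          rw [hz, ← Real.rpow_mul (by norm_num), ← mul_assoc, one_div_mul_cancel hr.ne', one_mul,
            Real.rpow_natCast]
      _ ≤ z ^ ∑ i, g (a i) := Real.rpow_le_rpow_of_exponent_le hz1 (Finset.mem_filter.mp ha).2
  have hup : (∑ x, z ^ g x) ^ L ≤ (2 * Fintype.card α : ℝ) ^ L :=
    pow_le_pow_left₀ (Finset.sum_nonneg fun x _ => (Real.rpow_pos_of_pos hz0 _).le) hmean L
  rw [hprod] at hlow
  have h := hlow.trans hup
  rw [mul_pow, show (16 : ℝ) = 2 * 8 by norm_num, mul_pow, mul_left_comm] at h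
  simpa using le_of_mul_le_mul_left h (by positivity)

/-! ### Families of tuples with small overlaps -/

/-- Greedy choice of an independent set: if every point has at most `D` in- and at most `D`
out-neighbours for the relation `r`, then a set with more than `2 * D * M` points has
`M` points that are pairwise unrelated. -/
theorem exists_pairwise_not_rel {Ω : Type*} [Fintype Ω] [DecidableEq Ω] (r : Ω → Ω → Prop)
    [DecidableRel r] (G : Finset Ω) {D : ℝ} (hD : 0 ≤ D)
    (hin : ∀ a ∈ G, ((Finset.univ.filter fun b => r b a).card : ℝ) ≤ D)
    (hout : ∀ a ∈ G, ((Finset.univ.filter fun b => r a b).card : ℝ) ≤ D) (M : ℕ)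
    (hM : 2 * D * M < G.card) :
    ∃ f : Fin M → Ω, (∀ m, f m ∈ G) ∧ ∀ m m', m ≠ m' → ¬ r (f m) (f m') := by
  induction M with
  | zero => exact ⟨Fin.elim0, fun m => m.elim0, fun m => m.elim0⟩
  | succ M ih =>
    obtain ⟨f, hfG, hf⟩ := ih (lt_of_le_of_lt (by gcongr; simp) hM)
    let bad : Finset Ω := Finset.univ.biUnion fun m =>
      (Finset.univ.filter fun b => r b (f m)) ∪ (Finset.univ.filter fun b => r (f m) b)
    have hbad : (bad.card : ℝ) ≤ 2 * D * M := by
      calc (bad.card : ℝ) ≤ ∑ m : Fin M, (((Finset.univ.filter fun b => r b (f m)) ∪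
            (Finset.univ.filter fun b => r (f m) b)).card : ℝ) := by
            exact_mod_cast Finset.card_biUnion_le
        _ ≤ ∑ _m : Fin M, 2 * D := Finset.sum_le_sum fun m _ => by
            have h := Finset.card_union_le (Finset.univ.filter fun b => r b (f m))
              (Finset.univ.filter fun b => r (f m) b)
            have h' : (((Finset.univ.filter fun b => r b (f m)) ∪
              (Finset.univ.filter fun b => r (f m) b)).card : ℝ) ≤
              (Finset.univ.filter fun b => r b (f m)).card +
              (Finset.univ.filter fun b => r (f m) b).card := by exact_mod_cast h
            linarith [hin _ (hfG m), hout _ (hfG m)]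
        _ = 2 * D * M := by simp; ring
    obtain ⟨x, hxG, hxb⟩ : ∃ x ∈ G, x ∉ bad := by
      by_contra! hsub
      have h1 : (G.card : ℝ) ≤ bad.card := by exact_mod_cast Finset.card_le_card hsub
      push_cast at hM
      nlinarith
    have hx : ∀ m, ¬ r x (f m) ∧ ¬ r (f m) x := fun m => by
      constructor <;> intro h <;> exact hxb (by
        simp only [bad, Finset.mem_biUnion, Finset.mem_union, Finset.mem_filter, Finset.mem_univ,
          true_and]
        exact ⟨m, by tauto⟩)
    refine ⟨Fin.cons x f, fun m => ?_, fun m m' hmm => ?_⟩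
    · refine Fin.cases hxG hfG m
    · induction m using Fin.cases with
      | zero =>
        induction m' using Fin.cases with
        | zero => exact absurd rfl hmm
        | succ m' => exact (hx m').1
      | succ m =>
        induction m' using Fin.cases with
        | zero => exact (hx m).2
        | succ m' => exact hf m m' fun h => hmm (by rw [h])

/-- There are `2 ^ L` tuples of length `L` in `α` along which all the functions of a family of at
most `2 ^ L` functions of small mean have small empirical mean, and any two of which overlap in
only a small fraction of their entries. -/
theorem exists_tuples {α : Type*} [Fintype α] [Nonempty α] [DecidableEq α] {r : ℝ}
    (hr : 0 < r) {T L : ℕ} (hL : 2 ≤ L) (hLα : (L : ℝ) ≤ threshold r * Fintype.card α)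
    (hT : T ≤ 2 ^ L) (g : Fin T → α → ℝ) (h0 : ∀ t x, 0 ≤ g t x) (h1 : ∀ t x, g t x ≤ 1)
    (hg : ∀ t, ∑ x, g t x ≤ threshold r * Fintype.card α) :
    ∃ a : Fin (2 ^ L) → Fin L → α, (∀ m t, ∑ i, g t (a m i) ≤ r * L) ∧
      ∀ m m', m ≠ m' →
        ((Finset.univ.filter fun i => a m i ∈ Finset.univ.image (a m')).card : ℝ) ≤ r * L := by
  classical
  set w : ℝ := (Fintype.card (Fin L → α) : ℝ) with hw
  have hw0 : 0 < w := by rw [hw]; exact_mod_cast Fintype.card_pos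
  have hLpos : (0 : ℝ) < L := by exact_mod_cast (by omega : 0 < L)
  let rel : (Fin L → α) → (Fin L → α) → Prop := fun a b =>
    r * L ≤ ((Finset.univ.filter fun i => a i ∈ Finset.univ.image b).card : ℝ)
  -- in-degrees are controlled by the Chernoff bound for the indicator of the range of `b`
  have hin : ∀ b, ((Finset.univ.filter fun a => rel a b).card : ℝ) * 8 ^ L ≤ w := fun b => by
    have h := card_tuples_mul_le (g := fun x => if x ∈ Finset.univ.image b then (1 : ℝ) else 0) hr
      (fun x => by split_ifs <;> norm_num)
      (fun x => by split_ifs <;> norm_num) (by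
        rw [Finset.sum_boole]
        refine le_trans ?_ hLα
        have : (Finset.univ.filter fun x => x ∈ Finset.univ.image b).card ≤ L := by
          rw [Finset.filter_mem_eq_inter, Finset.univ_inter]
          exact Finset.card_image_le.trans (by simp)
        exact_mod_cast this) L
    simpa only [Finset.sum_boole] using h
  set D : ℝ := 4 * w / 8 ^ L with hD
  have h8 : (0 : ℝ) < 8 ^ L := by positivity
  have hD0 : 0 < D := by positivity
  -- out-degrees are controlled on average only, hence for most tuples
  let P : Finset (Fin L → α) :=
    Finset.univ.filter fun a => D < ((Finset.univ.filter fun b => rel a b).card : ℝ)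
  have hP : 4 * (P.card : ℝ) ≤ w := by
    have hdc : ∑ a, (Finset.univ.filter fun b => rel a b).card =
        ∑ b, (Finset.univ.filter fun a => rel a b).card :=
      Finset.sum_card_bipartiteAbove_eq_sum_card_bipartiteBelow rel
    have hlow : (P.card : ℝ) * D ≤ ∑ a, ((Finset.univ.filter fun b => rel a b).card : ℝ) := by
      rw [← nsmul_eq_mul, ← Finset.sum_const]
      refine (Finset.sum_le_sum fun a ha => ?_).trans
        (Finset.sum_le_sum_of_subset_of_nonneg (Finset.subset_univ _) fun a _ _ => by positivity)
      exact (Finset.mem_filter.mp ha).2.le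
    have hup : ∑ b, ((Finset.univ.filter fun a => rel a b).card : ℝ) ≤ w * (w / 8 ^ L) := by
      calc _ ≤ ∑ _b : Fin L → α, w / 8 ^ L :=
            Finset.sum_le_sum fun b _ => by rw [le_div_iff₀ h8]; exact hin b
        _ = w * (w / 8 ^ L) := by rw [Finset.sum_const, nsmul_eq_mul, Finset.card_univ]
    have hdc' : ∑ a, ((Finset.univ.filter fun b => rel a b).card : ℝ) =
        ∑ b, ((Finset.univ.filter fun a => rel a b).card : ℝ) := by exact_mod_cast hdc
    have h := hlow.trans (hdc'.le.trans hup)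
    have h2 : (4 * (P.card : ℝ)) * (w / 8 ^ L) ≤ w * (w / 8 ^ L) := by
      calc _ = (P.card : ℝ) * D := by rw [hD]; ring
        _ ≤ _ := h
    exact le_of_mul_le_mul_right h2 (by positivity)
  let Q : Finset (Fin L → α) :=
    Finset.univ.biUnion fun t => Finset.univ.filter fun a => r * L ≤ ∑ i, g t (a i)
  have h4L : (16 : ℝ) ≤ 4 ^ L := by
    calc (16 : ℝ) = 4 ^ 2 := by norm_num
      _ ≤ 4 ^ L := pow_le_pow_right₀ (by norm_num) hL
  have h48 : (8 : ℝ) ^ L = 2 ^ L * 4 ^ L := by rw [← mul_pow]; norm_num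
  have hQ : 16 * (Q.card : ℝ) ≤ w := by
    have hc : (Q.card : ℝ) ≤ 2 ^ L * (w / 8 ^ L) := by
      calc (Q.card : ℝ) ≤ ∑ t, ((Finset.univ.filter fun a : Fin L → α =>
              r * L ≤ ∑ i, g t (a i)).card : ℝ) := by exact_mod_cast Finset.card_biUnion_le
        _ ≤ ∑ _t : Fin T, w / 8 ^ L := Finset.sum_le_sum fun t _ => by
            rw [le_div_iff₀ h8]; exact card_tuples_mul_le hr (h0 t) (h1 t) (hg t) L
        _ = T * (w / 8 ^ L) := by simp
        _ ≤ 2 ^ L * (w / 8 ^ L) := by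
            gcongr; exact_mod_cast hT
    have : (2 : ℝ) ^ L * (w / 8 ^ L) = w / 4 ^ L := by rw [h48]; field_simp
    rw [this, le_div_iff₀ (by positivity)] at hc
    nlinarith [(Nat.cast_nonneg Q.card : (0 : ℝ) ≤ Q.card)]
  let G : Finset (Fin L → α) := (P ∪ Q)ᶜ
  have hDM : 2 * D * (2 ^ L : ℕ) ≤ w / 2 := by
    have : 2 * D * (2 ^ L : ℕ) = 8 * w / 4 ^ L := by
      rw [hD, h48]; push_cast; field_simp; norm_num
    rw [this, div_le_iff₀ (by positivity)]
    nlinarith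
  have hGc : w / 2 < G.card := by
    have h := Finset.card_add_card_compl (P ∪ Q)
    have h' : ((P ∪ Q).card : ℝ) + G.card = w := by rw [hw]; exact_mod_cast h
    have hu : ((P ∪ Q).card : ℝ) ≤ P.card + Q.card := by exact_mod_cast Finset.card_union_le P Q
    linarith
  obtain ⟨f, hfG, hf⟩ := exists_pairwise_not_rel rel G hD0.le
    (fun a _ => by
      have := hin a
      rw [← le_div_iff₀ h8] at this
      refine this.trans ?_
      rw [hD]; gcongr; linarith)
    (fun a ha => by
      by_contra! h
      have : a ∈ P := Finset.mem_filter.mpr ⟨Finset.mem_univ _, h⟩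
      exact Finset.mem_compl.mp ha (Finset.mem_union_left _ this))
    (2 ^ L) (hDM.trans_lt hGc)
  refine ⟨f, fun m t => ?_, fun m m' hmm => (not_le.mp (hf m m' hmm)).le⟩
  by_contra! h
  exact Finset.mem_compl.mp (hfG m) (Finset.mem_union_right _ (Finset.mem_biUnion.mpr
    ⟨t, Finset.mem_univ _, Finset.mem_filter.mpr ⟨Finset.mem_univ _, h.le⟩⟩))

/-- The number of messages used for the parameter `s = 2 ^ (k * R)`, where `R` is the wanted
identification rate: `2 ^ ⌈s⌉`, or a single message if `s ≤ 1`, i.e. if the wanted rate is at most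
`0`. -/
noncomputable def numMessages (s : ℝ) : ℕ := if s ≤ 1 then 1 else 2 ^ ⌈s⌉₊

theorem numMessages_pos (s : ℝ) : 0 < numMessages s := by
  unfold numMessages; split_ifs <;> positivity

theorem numMessages_mono {s t : ℝ} (h : t ≤ s) : numMessages t ≤ numMessages s := by
  by_cases ht : t ≤ 1
  · rw [numMessages, if_pos ht]; exact numMessages_pos s
  · rw [numMessages, numMessages, if_neg ht, if_neg (by linarith)]
    exact Nat.pow_le_pow_right (by norm_num) (Nat.ceil_mono h)

/-- The family of `exists_tuples` with `numMessages s` members. If only one message is wanted, the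
tuple that lists all of `α` will do. -/
theorem exists_numMessages_tuples {α : Type*} [Fintype α] [Nonempty α] [DecidableEq α] {r : ℝ}
    (hr : 0 < r) (hr1 : r ≤ 1) {s : ℝ} (hs : 2 * s ≤ threshold r * Fintype.card α)
    {T : ℕ} (hT : T ≤ numMessages s) (g : Fin T → α → ℝ) (h0 : ∀ t x, 0 ≤ g t x)
    (h1 : ∀ t x, g t x ≤ 1) (hg : ∀ t, ∑ x, g t x ≤ threshold r * Fintype.card α) :
    ∃ L : ℕ, 0 < L ∧ ∃ a : Fin (numMessages s) → Fin L → α,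
      (∀ m t, ∑ i, g t (a m i) ≤ r * L) ∧ ∀ m m', m ≠ m' →
        ((Finset.univ.filter fun i => a m i ∈ Finset.univ.image (a m')).card : ℝ) ≤ r * L := by
  by_cases hs1 : s ≤ 1
  · have h : numMessages s = 1 := if_pos hs1
    rw [h]
    refine ⟨Fintype.card α, Fintype.card_pos, fun _ => (Fintype.equivFin α).symm, fun _ t => ?_,
      fun m m' hmm => absurd (Subsingleton.elim m m') hmm⟩
    rw [Equiv.sum_comp (Fintype.equivFin α).symm (g t)]
    exact (hg t).trans (by gcongr; exact threshold_le_self hr hr1)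
  · have h : numMessages s = 2 ^ ⌈s⌉₊ := if_neg hs1
    rw [h] at hT ⊢
    push Not at hs1
    have h2 : 2 ≤ ⌈s⌉₊ := by
      have : 1 < ⌈s⌉₊ := Nat.lt_ceil.mpr (by exact_mod_cast hs1)
      omega
    refine ⟨⌈s⌉₊, by omega, exists_tuples hr h2 ?_ hT g h0 h1 hg⟩
    have := Nat.ceil_lt_add_one (by linarith : 0 ≤ s)
    linarith

/-- The case `t ≤ s` of `exists_rectangles`, where the tuples in `β` form the smaller family. -/
theorem exists_rectangles_of_le {α β : Type*} [Fintype α] [Nonempty α] [DecidableEq α] [Fintype β]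
    [Nonempty β] [DecidableEq β] {e : α → β → ℝ} (h0 : ∀ x y, 0 ≤ e x y) (h1 : ∀ x y, e x y ≤ 1)
    {r : ℝ} (hr : 0 < r) (hr1 : r ≤ 1)
    (he : ∑ x, ∑ y, e x y ≤ threshold (threshold r) * (Fintype.card α * Fintype.card β)) {s t : ℝ}
    (hs : 2 * s ≤ threshold (threshold r) * Fintype.card α)
    (ht : 2 * t ≤ threshold (threshold r) * Fintype.card β) (hts : t ≤ s) :
    ∃ L K : ℕ, 0 < L ∧ 0 < K ∧ ∃ (a : Fin (numMessages s) → Fin L → α)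
      (b : Fin (numMessages t) → Fin K → β),
      (∀ m n, ∑ i, ∑ j, e (a m i) (b n j) ≤ r * (L * K)) ∧
      (∀ m m', m ≠ m' →
        ((Finset.univ.filter fun i => a m i ∈ Finset.univ.image (a m')).card : ℝ) ≤ r * L) ∧
      (∀ n n', n ≠ n' →
        ((Finset.univ.filter fun j => b n j ∈ Finset.univ.image (b n')).card : ℝ) ≤ r * K) := by
  have hr' := threshold_pos r
  have hrr := threshold_le_self hr hr1
  have hrr' := threshold_le_self hr' (hrr.trans hr1)
  have hα : (0 : ℝ) < Fintype.card α := by exact_mod_cast Fintype.card_pos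
  -- the tuples in `β` only have to be good on average over `α`
  obtain ⟨K, hK, b, hb, hbo⟩ := exists_numMessages_tuples hr' (hrr.trans hr1) ht
    (T := 1) (numMessages_pos t) (fun _ y => (∑ x, e x y) / Fintype.card α)
    (fun _ y => div_nonneg (Finset.sum_nonneg fun x _ => h0 x y) hα.le)
    (fun _ y => by
      rw [div_le_one hα]
      calc ∑ x, e x y ≤ ∑ _x : α, (1 : ℝ) := Finset.sum_le_sum fun x _ => h1 x y
        _ = _ := by simp)
    (fun _ => by
      rw [← Finset.sum_div, div_le_iff₀ hα, Finset.sum_comm]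
      linarith)
  have hK' : (0 : ℝ) < K := by exact_mod_cast hK
  -- each tuple in `α` has to be good for every one of the tuples in `β`
  obtain ⟨L, hL, a, ha, hao⟩ := exists_numMessages_tuples hr hr1
    (hs.trans (by gcongr)) (numMessages_mono hts) (fun n x => (∑ j, e x (b n j)) / K)
    (fun n x => div_nonneg (Finset.sum_nonneg fun j _ => h0 _ _) hK'.le)
    (fun n x => by
      rw [div_le_one hK']
      calc ∑ j, e x (b n j) ≤ ∑ _j : Fin K, (1 : ℝ) := Finset.sum_le_sum fun j _ => h1 _ _
        _ = _ := by simp)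
    (fun n => by
      have h := hb n 0
      rw [← Finset.sum_div, div_le_iff₀ hα, Finset.sum_comm] at h
      rw [← Finset.sum_div, div_le_iff₀ hK']
      linarith)
  refine ⟨L, K, hL, hK, a, b, fun m n => ?_, hao, fun n n' hn => (hbo n n' hn).trans (by gcongr)⟩
  have h := ha m n
  rw [← Finset.sum_div, div_le_iff₀ hK'] at h
  linarith

/-- If a `[0, 1]`-valued matrix has small mean, then there are families of tuples of rows and of
tuples of columns such that the mean over every rectangle is small and distinct tuples of either
family have small overlap. The smaller family is chosen first, with control only of its mean over all
rows or columns; in the choice of the larger one, the failure probability of a random tuple then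
beats a union bound over the smaller family. -/
theorem exists_rectangles {α β : Type*} [Fintype α] [Nonempty α] [DecidableEq α] [Fintype β]
    [Nonempty β] [DecidableEq β] {e : α → β → ℝ} (h0 : ∀ x y, 0 ≤ e x y) (h1 : ∀ x y, e x y ≤ 1)
    {r : ℝ} (hr : 0 < r) (hr1 : r ≤ 1)
    (he : ∑ x, ∑ y, e x y ≤ threshold (threshold r) * (Fintype.card α * Fintype.card β)) {s t : ℝ}
    (hs : 2 * s ≤ threshold (threshold r) * Fintype.card α)
    (ht : 2 * t ≤ threshold (threshold r) * Fintype.card β) :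
    ∃ L K : ℕ, 0 < L ∧ 0 < K ∧ ∃ (a : Fin (numMessages s) → Fin L → α)
      (b : Fin (numMessages t) → Fin K → β),
      (∀ m n, ∑ i, ∑ j, e (a m i) (b n j) ≤ r * (L * K)) ∧
      (∀ m m', m ≠ m' →
        ((Finset.univ.filter fun i => a m i ∈ Finset.univ.image (a m')).card : ℝ) ≤ r * L) ∧
      (∀ n n', n ≠ n' →
        ((Finset.univ.filter fun j => b n j ∈ Finset.univ.image (b n')).card : ℝ) ≤ r * K) := by
  rcases le_total t s with h | h
  · exact exists_rectangles_of_le h0 h1 hr hr1 he hs ht h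
  · obtain ⟨K, L, hK, hL, b, a, hab, hb, ha⟩ := exists_rectangles_of_le
      (e := fun y x => e x y) (fun y x => h0 x y) (fun y x => h1 x y) hr hr1
      (by rw [Finset.sum_comm, mul_comm (Fintype.card β : ℝ)]; exact he) ht hs h
    refine ⟨L, K, hL, hK, a, b, fun m n => ?_, ha, hb⟩
    rw [Finset.sum_comm, mul_comm (L : ℝ)]
    exact hab n m

/-! ### From transmission codes to simultaneous ID-codes -/

theorem trace_mul_re_nonneg {d : Type*} [Fintype d] {A B : Matrix d d ℂ} (hA : A.PosSemidef)
    (hB : B.PosSemidef) : 0 ≤ (A * B).trace.re := by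
  classical
  open scoped MatrixOrder Matrix.Norms.L2Operator in
  obtain ⟨C, rfl⟩ : ∃ C : Matrix d d ℂ, B = Cᴴ * C :=
    CStarAlgebra.nonneg_iff_eq_star_mul_self.mp (Matrix.nonneg_iff_posSemidef.mpr hB)
  rw [← mul_assoc, Matrix.trace_mul_comm, ← mul_assoc]
  exact (Complex.nonneg_iff.mp (hA.mul_mul_conjTranspose_same C).trace_nonneg).1

namespace TransmissionCode

variable {X Y d : Type*} [Fintype d] [DecidableEq d] {k M' N' : ℕ}

/-- The probability that `(u, v)` is decoded when `(i, j)` is sent. -/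
def decodeProb (C : TransmissionCode X Y d k M' N') (W : Channel X Y d) (i : Fin M') (j : Fin N')
    (p : Fin M' × Fin N') : ℝ :=
  (C.D p * (W k (C.x i) (C.y j)).val).trace.re

theorem decodeProb_nonneg (C : TransmissionCode X Y d k M' N') (W : Channel X Y d) (i : Fin M')
    (j : Fin N') (p : Fin M' × Fin N') : 0 ≤ C.decodeProb W i j p :=
  trace_mul_re_nonneg (C.isPOVM.1 p) (W k (C.x i) (C.y j)).posSemidef

theorem sum_decodeProb (C : TransmissionCode X Y d k M' N') (W : Channel X Y d) (i : Fin M')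
    (j : Fin N') : ∑ p, C.decodeProb W i j p = 1 := by
  simp only [decodeProb]
  rw [← Complex.re_sum, ← Matrix.trace_sum, ← Finset.sum_mul, C.isPOVM.2, one_mul,
    (W k (C.x i) (C.y j)).trace_eq_one, Complex.one_re]

theorem sum_decodeProb_le_one (C : TransmissionCode X Y d k M' N') (W : Channel X Y d) (i : Fin M')
    (j : Fin N') (s : Finset (Fin M' × Fin N')) : ∑ p ∈ s, C.decodeProb W i j p ≤ 1 :=
  (Finset.sum_le_sum_of_subset_of_nonneg (Finset.subset_univ s) fun p _ _ =>
    C.decodeProb_nonneg W i j p).trans_eq (C.sum_decodeProb W i j)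

theorem sum_decodeProb_le_of_notMem (C : TransmissionCode X Y d k M' N') (W : Channel X Y d)
    (i : Fin M') (j : Fin N') {s : Finset (Fin M' × Fin N')} (h : (i, j) ∉ s) :
    ∑ p ∈ s, C.decodeProb W i j p ≤ 1 - C.decodeProb W i j (i, j) := by
  have := C.sum_decodeProb_le_one W i j (insert (i, j) s)
  rw [Finset.sum_insert h] at this
  linarith

theorem decodeProb_le_one (C : TransmissionCode X Y d k M' N') (W : Channel X Y d)
    (i : Fin M') (j : Fin N') (p : Fin M' × Fin N') : C.decodeProb W i j p ≤ 1 := by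
  simpa using C.sum_decodeProb_le_one W i j {p}

theorem sum_error (C : TransmissionCode X Y d k M' N') (W : Channel X Y d) (hM : 0 < M')
    (hN : 0 < N') :
    ∑ i, ∑ j, (1 - C.decodeProb W i j (i, j)) = C.avgError W * (M' * N') := by
  have hM' : (M' : ℝ) ≠ 0 := by positivity
  have hN' : (N' : ℝ) ≠ 0 := by positivity
  simp only [avgError, decodeProb, Finset.sum_sub_distrib, Finset.sum_const, Finset.card_univ,
    Fintype.card_fin, nsmul_eq_mul]
  field_simp

variable [Fintype X] [Fintype Y] {M N L K : ℕ}

open Classical in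
/-- The ID-code built from a transmission code and families `a`, `b` of tuples of messages: to send
`m`, the first sender transmits an entry of the tuple `a m` picked uniformly at random, and the test
for `(m, n)` accepts if the decoded pair has its components in the ranges of `a m` and `b n`. -/
noncomputable def toIDCode (C : TransmissionCode X Y d k M' N') (hL : 0 < L) (hK : 0 < K)
    (a : Fin M → Fin L → Fin M') (b : Fin N → Fin K → Fin N') : IDCode X Y d k M N where
  P m x := ∑ i, if C.x (a m i) = x then 1 / (L : ℝ) else 0
  Q n y := ∑ j, if C.y (b n j) = y then 1 / (K : ℝ) else 0
  I m n := ∑ u ∈ Finset.univ.image (a m), ∑ v ∈ Finset.univ.image (b n), C.D (u, v)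
  P_mem m := by
    refine ⟨fun x => Finset.sum_nonneg fun i _ => by split_ifs <;> positivity, ?_⟩
    rw [Finset.sum_comm]
    have : (L : ℝ) ≠ 0 := by positivity
    simp [this]
  Q_mem n := by
    refine ⟨fun x => Finset.sum_nonneg fun i _ => by split_ifs <;> positivity, ?_⟩
    rw [Finset.sum_comm]
    have : (K : ℝ) ≠ 0 := by positivity
    simp [this]
  I_nonneg m n := by
    rw [← Finset.sum_product']
    exact Matrix.posSemidef_sum _ fun p _ => C.isPOVM.1 p
  I_le_one m n := by
    rw [← Finset.sum_product', ← C.isPOVM.2, ← Finset.sum_compl_add_sum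
      (Finset.univ.image (a m) ×ˢ Finset.univ.image (b n)), add_sub_cancel_right]
    exact Matrix.posSemidef_sum _ fun p _ => C.isPOVM.1 p

theorem toIDCode_isSimultaneous (C : TransmissionCode X Y d k M' N') (hL : 0 < L) (hK : 0 < K)
    (a : Fin M → Fin L → Fin M') (b : Fin N → Fin K → Fin N') :
    (C.toIDCode hL hK a b).IsSimultaneous := by
  classical
  refine ⟨M', N', C.D, fun m => Finset.univ.image (a m), fun n => Finset.univ.image (b n),
    C.isPOVM, fun m n => ?_⟩
  simp only [toIDCode]

theorem toIDCode_acceptProb (C : TransmissionCode X Y d k M' N') (W : Channel X Y d) (hL : 0 < L)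
    (hK : 0 < K) (a : Fin M → Fin L → Fin M') (b : Fin N → Fin K → Fin N') (m : Fin M) (n : Fin N)
    (m' : Fin M) (n' : Fin N) :
    (C.toIDCode hL hK a b).acceptProb W m n m' n' = (∑ i, ∑ j,
      ∑ p ∈ Finset.univ.image (a m') ×ˢ Finset.univ.image (b n'),
        C.decodeProb W (a m i) (b n j) p) / (L * K) := by
  classical
  have htr : ∀ x y, ((C.toIDCode hL hK a b).I m' n' * (W k x y).val).trace.re =
      ∑ p ∈ Finset.univ.image (a m') ×ˢ Finset.univ.image (b n'),
        (C.D p * (W k x y).val).trace.re := fun x y => by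
    have hI : (C.toIDCode hL hK a b).I m' n' =
        ∑ p ∈ Finset.univ.image (a m') ×ˢ Finset.univ.image (b n'), C.D p := by
      rw [Finset.sum_product]; simp only [toIDCode]
    rw [hI, Finset.sum_mul, Matrix.trace_sum, Complex.re_sum]
  unfold IDCode.acceptProb
  simp only [htr]
  set F : (Fin k → X) → (Fin k → Y) → ℝ := fun x y =>
    ∑ p ∈ Finset.univ.image (a m') ×ˢ Finset.univ.image (b n'),
      (C.D p * (W k x y).val).trace.re with hF
  change ∑ x, ∑ y, (C.toIDCode hL hK a b).P m x * (C.toIDCode hL hK a b).Q n y * F x y =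
    (∑ i, ∑ j, F (C.x (a m i)) (C.y (b n j))) / (L * K)
  have hQ : ∀ x, ∑ y, (C.toIDCode hL hK a b).P m x * (C.toIDCode hL hK a b).Q n y * F x y =
      (C.toIDCode hL hK a b).P m x * ((∑ j, F x (C.y (b n j))) / K) := fun x => by
    simp only [mul_assoc, ← Finset.mul_sum]
    congr 1
    simp only [toIDCode, Finset.sum_mul]
    rw [Finset.sum_comm, Finset.sum_div]
    refine Finset.sum_congr rfl fun j _ => ?_
    simp only [ite_mul, zero_mul, Finset.sum_ite_eq, Finset.mem_univ, if_true]
    ring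
  simp only [hQ]
  simp only [toIDCode, Finset.sum_mul]
  rw [Finset.sum_comm, Finset.sum_div]
  refine Finset.sum_congr rfl fun i _ => ?_
  simp only [ite_mul, zero_mul, Finset.sum_ite_eq, Finset.mem_univ, if_true]
  field_simp

theorem toIDCode_error₁_le (C : TransmissionCode X Y d k M' N') (W : Channel X Y d) (hL : 0 < L)
    (hK : 0 < K) {a : Fin M → Fin L → Fin M'} {b : Fin N → Fin K → Fin N'} {r : ℝ} (hr : 0 ≤ r)
    (hab : ∀ m n, ∑ i, ∑ j, (1 - C.decodeProb W (a m i) (b n j) (a m i, b n j)) ≤ r * (L * K)) :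
    (C.toIDCode hL hK a b).error₁ W ≤ r := by
  refine Real.iSup_le (fun ⟨m, n⟩ => ?_) hr
  have hL' : (0 : ℝ) < L := by positivity
  have hK' : (0 : ℝ) < K := by positivity
  have h : ∑ i, ∑ j, C.decodeProb W (a m i) (b n j) (a m i, b n j) ≤ ∑ i, ∑ j,
      ∑ p ∈ Finset.univ.image (a m) ×ˢ Finset.univ.image (b n),
        C.decodeProb W (a m i) (b n j) p :=
    Finset.sum_le_sum fun i _ => Finset.sum_le_sum fun j _ =>
      Finset.single_le_sum (f := C.decodeProb W (a m i) (b n j))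
        (fun p _ => C.decodeProb_nonneg W _ _ p) (Finset.mem_product.mpr
        ⟨Finset.mem_image_of_mem _ (Finset.mem_univ i), Finset.mem_image_of_mem _ (Finset.mem_univ j)⟩)
  have h2 := hab m n
  simp only [Finset.sum_sub_distrib, Finset.sum_const, Finset.card_univ,
    Fintype.card_fin, nsmul_eq_mul, mul_one] at h2
  simp only [toIDCode_acceptProb]
  rw [sub_le_comm, le_div_iff₀ (by positivity)]
  linarith

theorem toIDCode_error₂_le (C : TransmissionCode X Y d k M' N') (W : Channel X Y d) (hL : 0 < L)
    (hK : 0 < K) {a : Fin M → Fin L → Fin M'} {b : Fin N → Fin K → Fin N'} {r : ℝ} (hr : 0 ≤ r)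
    (hab : ∀ m n, ∑ i, ∑ j, (1 - C.decodeProb W (a m i) (b n j) (a m i, b n j)) ≤ r * (L * K))
    (ha : ∀ m m', m ≠ m' →
      ((Finset.univ.filter fun i => a m i ∈ Finset.univ.image (a m')).card : ℝ) ≤ r * L)
    (hb : ∀ n n', n ≠ n' →
      ((Finset.univ.filter fun j => b n j ∈ Finset.univ.image (b n')).card : ℝ) ≤ r * K) :
    (C.toIDCode hL hK a b).error₂ W ≤ 2 * r := by
  refine Real.iSup_le (fun ⟨⟨⟨m, n⟩, ⟨m', n'⟩⟩, hne⟩ => ?_) (by positivity)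
  have hL' : (0 : ℝ) < L := by positivity
  have hK' : (0 : ℝ) < K := by positivity
  simp only [toIDCode_acceptProb]
  rw [div_le_iff₀ (by positivity)]
  -- false acceptance needs a decoding error or a sent pair that lies in the wrong rectangle
  have key : ∀ i j, ∑ p ∈ Finset.univ.image (a m') ×ˢ Finset.univ.image (b n'),
      C.decodeProb W (a m i) (b n j) p ≤
      (1 - C.decodeProb W (a m i) (b n j) (a m i, b n j)) +
      (if a m i ∈ Finset.univ.image (a m') then 1 else 0) *
        (if b n j ∈ Finset.univ.image (b n') then 1 else 0) := fun i j => by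
    by_cases h : (a m i, b n j) ∈ Finset.univ.image (a m') ×ˢ Finset.univ.image (b n')
    · have h' := Finset.mem_product.mp h
      rw [if_pos h'.1, if_pos h'.2]
      linarith [C.sum_decodeProb_le_one W (a m i) (b n j)
        (Finset.univ.image (a m') ×ˢ Finset.univ.image (b n')),
        C.decodeProb_le_one W (a m i) (b n j) (a m i, b n j)]
    · refine (C.sum_decodeProb_le_of_notMem W _ _ h).trans (le_add_of_nonneg_right ?_)
      split_ifs <;> norm_num
  have hsum := Finset.sum_le_sum fun i (_ : i ∈ Finset.univ) =>
    Finset.sum_le_sum fun j (_ : j ∈ Finset.univ) => key i j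
  refine hsum.trans ?_
  simp only [Finset.sum_add_distrib]
  rw [← Finset.sum_mul_sum, Finset.sum_boole, Finset.sum_boole]
  set p : ℝ := ((Finset.univ.filter fun i => a m i ∈ Finset.univ.image (a m')).card : ℝ) with hp
  set q : ℝ := ((Finset.univ.filter fun j => b n j ∈ Finset.univ.image (b n')).card : ℝ) with hq
  have hpL : p ≤ L := by
    rw [hp]; exact_mod_cast (Finset.card_le_univ _).trans_eq (Fintype.card_fin L)
  have hqK : q ≤ K := by
    rw [hq]; exact_mod_cast (Finset.card_le_univ _).trans_eq (Fintype.card_fin K)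
  have hp0 : 0 ≤ p := Nat.cast_nonneg _
  have hq0 : 0 ≤ q := Nat.cast_nonneg _
  have hpq : p * q ≤ r * (L * K) := by
    by_cases hm : m = m'
    · have hn : n ≠ n' := fun hn => hne (by rw [hm, hn])
      calc p * q ≤ L * (r * K) := mul_le_mul hpL (hb n n' hn) hq0 hL'.le
        _ = r * (L * K) := by ring
    · calc p * q ≤ (r * L) * K := mul_le_mul (ha m m' hm) hqK hq0 (by positivity)
        _ = r * (L * K) := by ring
  linarith [hab m n]

end TransmissionCode

/-! ### Rates -/

theorem le_idRate_numMessages {k : ℕ} (hk : 0 < k) (R : ℝ) :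
    R ≤ idRate k (numMessages ((2 : ℝ) ^ (k * R))) := by
  have hk' : (0 : ℝ) < k := by positivity
  by_cases h : (2 : ℝ) ^ (k * R) ≤ 1
  · have hR : k * R ≤ 0 := by
      by_contra! hpos
      exact absurd h (not_le.mpr (Real.one_lt_rpow (by norm_num) hpos))
    rw [numMessages, if_pos h, idRate, if_pos le_rfl]
    by_contra! hpos
    nlinarith
  · have hceil : 0 < ⌈(2 : ℝ) ^ (k * R)⌉₊ := Nat.ceil_pos.mpr (by positivity)
    have h1 : ¬ (2 ^ ⌈(2 : ℝ) ^ (k * R)⌉₊ ≤ 1) :=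
      not_le.mpr (Nat.one_lt_pow hceil.ne' (by norm_num))
    rw [numMessages, if_neg h, idRate, if_neg h1]
    push_cast
    rw [← Real.rpow_natCast 2, Real.logb_rpow (by norm_num) (by norm_num), one_div,
      le_inv_mul_iff₀ hk', Real.le_logb_iff_rpow_le (by norm_num) (by exact_mod_cast hceil)]
    exact Nat.le_ceil _

/-- A code size of rate at least `R - δ / 2` exceeds `2 ^ (k * (R - δ))` by an arbitrary constant
factor, once `k` is large. -/
theorem two_mul_rpow_le {c : ℝ} (hc : 0 < c) {R δ : ℝ} {k M : ℕ} (hk : 0 < k) (hM : 0 < M)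
    (hbig : 2 / c ≤ (2 : ℝ) ^ ((k : ℝ) * (δ / 2)))
    (hrate : 1 / (k : ℝ) * Real.logb 2 M ≥ R - δ / 2) :
    2 * (2 : ℝ) ^ (k * (R - δ)) ≤ c * M := by
  have hk' : (0 : ℝ) < k := by positivity
  rw [ge_iff_le, one_div, le_inv_mul_iff₀ hk', Real.le_logb_iff_rpow_le (by norm_num)
    (by exact_mod_cast hM)] at hrate
  rw [div_le_iff₀ hc] at hbig
  have hsplit : (2 : ℝ) ^ (k * (R - δ / 2)) = 2 ^ (k * (R - δ)) * 2 ^ ((k : ℝ) * (δ / 2)) := by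
    rw [← Real.rpow_add (by norm_num)]; congr 1; ring
  have hpos : (0 : ℝ) < 2 ^ (k * (R - δ)) := by positivity
  calc 2 * (2 : ℝ) ^ (k * (R - δ)) ≤ (2 ^ ((k : ℝ) * (δ / 2)) * c) * 2 ^ (k * (R - δ)) := by
        gcongr
    _ = c * 2 ^ (k * (R - δ / 2)) := by rw [hsplit]; ring
    _ ≤ c * M := by gcongr

end CCQ

/-- Achievability: the message transmission capacity region of a discrete memoryless CCQ channel is
contained in its simultaneous identification capacity region. -/
theorem theorem2 {X Y d : Type*} [Fintype X] [Fintype Y] [Fintype d] [DecidableEq d]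
    (W : X → Y → CCQ.DensityMatrix d) :
    CCQ.capacityRegion (CCQ.memoryless W) ⊆ CCQ.simIDCapacityRegion (CCQ.memoryless W) := by
  rintro ⟨R₁, R₂⟩ ⟨hR₁, hR₂, hach⟩
  refine ⟨hR₁, hR₂, fun ε₁ hε₁ ε₂ hε₂ δ hδ => ?_⟩
  dsimp only at hach ⊢
  set r : ℝ := min 1 (min ε₁ (ε₂ / 2)) with hr_def
  have hr : 0 < r := lt_min one_pos (lt_min hε₁ (by positivity))
  have hr1 : r ≤ 1 := min_le_left _ _
  have hrε₁ : r ≤ ε₁ := (min_le_right _ _).trans (min_le_left _ _)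
  have hrε₂ : r ≤ ε₂ / 2 := (min_le_right _ _).trans (min_le_right _ _)
  set c : ℝ := CCQ.threshold (CCQ.threshold r) with hc_def
  have hc : 0 < c := CCQ.threshold_pos _
  obtain ⟨k₀, hk₀⟩ := hach c hc (δ / 2) (by positivity)
  have hlim : Filter.Tendsto (fun k : ℕ => (2 : ℝ) ^ ((k : ℝ) * (δ / 2))) Filter.atTop
      Filter.atTop :=
    (tendsto_rpow_atTop_of_base_gt_one 2 (by norm_num)).comp
      (tendsto_natCast_atTop_atTop.atTop_mul_const (by positivity))
  obtain ⟨k₁, hk₁⟩ := Filter.eventually_atTop.mp (hlim.eventually_ge_atTop (2 / c))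
  refine ⟨max k₀ (max k₁ 1), fun k hk => ?_⟩
  have hk0 : k₀ ≤ k := (le_max_left _ _).trans hk
  have hk1 : k₁ ≤ k := ((le_max_left _ _).trans (le_max_right _ _)).trans hk
  have hkpos : 0 < k := ((le_max_right _ _).trans (le_max_right _ _)).trans hk
  obtain ⟨M', N', hM', hN', C, hrateM, hrateN, herr⟩ := hk₀ k hk0
  have : NeZero M' := ⟨hM'.ne'⟩
  have : NeZero N' := ⟨hN'.ne'⟩
  obtain ⟨L, K, hL, hK, a, b, hab, ha, hb⟩ := CCQ.exists_rectangles
    (e := fun i j => 1 - C.decodeProb (CCQ.memoryless W) i j (i, j))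
    (fun i j => by linarith [C.decodeProb_le_one (CCQ.memoryless W) i j (i, j)])
    (fun i j => by linarith [C.decodeProb_nonneg (CCQ.memoryless W) i j (i, j)])
    hr hr1 (by
      rw [C.sum_error _ hM' hN', Fintype.card_fin, Fintype.card_fin]
      gcongr)
    (s := (2 : ℝ) ^ (k * (R₁ - δ))) (t := (2 : ℝ) ^ (k * (R₂ - δ)))
    (by
      rw [Fintype.card_fin]
      exact CCQ.two_mul_rpow_le hc hkpos hM' (hk₁ k hk1) hrateM)
    (by
      rw [Fintype.card_fin]
      exact CCQ.two_mul_rpow_le hc hkpos hN' (hk₁ k hk1) hrateN)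
  refine ⟨_, _, CCQ.numMessages_pos _, CCQ.numMessages_pos _, C.toIDCode hL hK a b,
    C.toIDCode_isSimultaneous hL hK a b, CCQ.le_idRate_numMessages hkpos _,
    CCQ.le_idRate_numMessages hkpos _, ?_, ?_⟩
  · exact (C.toIDCode_error₁_le _ hL hK hr.le hab).trans hrε₁
  · exact (C.toIDCode_error₂_le _ hL hK hr.le hab ha hb).trans (by linarith)
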